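/- Let $\Gamma=(V,E)$ be a finite undirected graph with loops allowed, and let $\mathbb{M}_\Gamma$ be its graph monoid: the quotient of $(V\cup\bar V)^*$ by the relations $v\bar v=\varepsilon$ for $v\in V$, and $xy=yx$ for $x\in\{u,\bar u\}$, $y\in\{v,\bar v\}$ with $\{u,v\}\in E$ (for a loop, $u=v$). Write $[u]$ for the element represented by a word $u$. Assume $\Gamma\in\mathsf{PD}(\mathsf{Grp})$, i.e. every unlooped vertex is isolated (unlooped vertices are pushdown letters). Let $W$ be the set of looped vertices, and for $w\in(W\cup\bar W)^*$ let $\|w\|$ be the length of a shortest word $u\in(W\cup\bar W)^*$ with $[u]=[w]$. Let $\mathtt{G}=(\Gamma,Q=Q_\exists\sqcup Q_\forall,\delta,q_{init})$ be a game arena over $\Gamma$ with a finite set of states $Q$, where every transition $(p,x,q)\in\delta$ has a label $x\in V\cup\bar V\cup\{\varepsilon\}$, every state has an outgoing transition, and for all $p,q\in Q$ there is at most one transition from $p$ to $q$. A play is an infinite sequence of configurations in $Q\times\mathbb{M}_\Gamma$ in which each step goes from some $(p,g)$ to $(q,g[x])$ with $(p,x,q)\in\delta$; the owner of the current state chooses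 the transition, and strategies may depend on the sequence of states visited so far. The existential player $\exists$ wins a configuration if she has a strategy such that every play from this configuration that complies with it visits only configurations $(q,g)$ with $g$ right-invertible in $\mathbb{M}_\Gamma$. Let $n=|Q|$, let $\gamma\in V$ be an unlooped vertex, let $\lambda,\lambda'\in(V\cup\bar V)^*$ with $[\lambda']$ right-invertible (i.e. $\lambda'$ represents a valid stack content), and let $w\in(W\cup\bar W)^*$ with $\|w\|>n$. If $\exists$ wins $(q_{init},[\lambda\gamma w\gamma\lambda'])$, then she also wins $(q_{init},[\gamma\lambda'])$. -/

import Mathlib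

namespace Viability

/-- An undirected graph on the vertex set `V` in which loops are allowed. -/
structure ValenceGraph (V : Type*) where
  Adj : V → V → Prop
  symm : ∀ u v, Adj u v → Adj v u

/-- The letters of the alphabet `V ∪ V̄`: `pos v` is `v` and `neg v` is `v̄`. -/
inductive Letter (V : Type*) where
  | pos (v : V) : Letter V
  | neg (v : V) : Letter V

/-- The vertex underlying a letter of `V ∪ V̄`. -/
def Letter.vertex {V : Type*} : Letter V → V
  | .pos v => v
  | .neg v => v

/-- Words over `V ∪ V̄`. -/
abbrev Word (V : Type*) := FreeMonoid (Letter V)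

/-- The one-letter word `v`. -/
def push {V : Type*} (v : V) : Word V := FreeMonoid.of (Letter.pos v)

/-- The one-letter word `v̄`. -/
def pop {V : Type*} (v : V) : Word V := FreeMonoid.of (Letter.neg v)

namespace ValenceGraph

variable {V : Type*} (Γ : ValenceGraph V)

/-- A vertex with a self-loop. -/
def Looped (v : V) : Prop := Γ.Adj v v

/-- The defining relations of the graph monoid: `v v̄ = 1` for every vertex `v`, and `x y = y x`
whenever the vertices underlying the letters `x` and `y` are adjacent (or equal and looped). -/
inductive Rel : Word V → Word V → Prop
  | cancel (v : V) : Rel (push v * pop v) 1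
  | comm (x y : Letter V) (h : Γ.Adj x.vertex y.vertex) :
      Rel (FreeMonoid.of x * FreeMonoid.of y) (FreeMonoid.of y * FreeMonoid.of x)

/-- The graph monoid `𝕄_Γ`. -/
abbrev GraphMonoid := PresentedMonoid Γ.Rel

/-- The element `[w]` of the graph monoid represented by the word `w`. -/
def cls : Word V →* Γ.GraphMonoid := PresentedMonoid.mk Γ.Rel

/-- `Γ` belongs to `PD(Grp)`: the unlooped vertices (the pushdown letters) are isolated;
the looped vertices (the generators of the group) carry an arbitrary graph. -/
def IsPDGrp : Prop := ∀ u v : V, ¬ Γ.Looped u → ¬ Γ.Adj u v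

/-- The word `w` is over `W ∪ W̄`, where `W` is the set of looped vertices. -/
def IsGroupWord (w : Word V) : Prop := ∀ x ∈ FreeMonoid.toList w, Γ.Looped x.vertex

/-- The word length `‖g‖`: the least length of a word over `W ∪ W̄` that represents `g`.
It is meaningful only for those `g` that are represented by such a word. -/
noncomputable def wordLength (g : Γ.GraphMonoid) : ℕ :=
  sInf {k | ∃ u : Word V, Γ.IsGroupWord u ∧ Γ.cls u = g ∧ u.length = k}

end ValenceGraph

/-- The set of right-invertible elements of a monoid. -/
def RInv (M : Type*) [Monoid M] : Set M := {x | ∃ y, x * y = 1}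

/-- A valence game arena over `Γ` with state set `Q`. The states in `existential` are owned by the
existential player, all others by the universal player. -/
structure GameArena {V : Type*} (Γ : ValenceGraph V) (Q : Type*) where
  existential : Set Q
  δ : Set (Q × Word V × Q)
  init : Q
  exists_transition : ∀ p, ∃ x q, (p, x, q) ∈ δ
  transition_unique : ∀ p q x y, (p, x, q) ∈ δ → (p, y, q) ∈ δ → x = y

namespace GameArena

variable {V Q : Type*} {Γ : ValenceGraph V} (G : GameArena Γ Q)

/-- Every transition carries a letter of `V ∪ V̄` or the empty word. -/
def SingleLetter : Prop := ∀ p x q, (p, x, q) ∈ G.δ → x.length ≤ 1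

/-- A play is an infinite run: a sequence of configurations in which each step follows a
transition `(p, x, q)` and multiplies the storage content by `[x]` on the right. -/
def IsPlay (π : ℕ → Q × Γ.GraphMonoid) : Prop :=
  ∀ i, ∃ x, ((π i).1, x, (π (i + 1)).1) ∈ G.δ ∧ (π (i + 1)).2 = (π i).2 * Γ.cls x

/-- A strategy of the existential player: `σ h q` is the state chosen in the current state `q`,
after the sequence `h` of previously visited states. -/
def IsStrategy (σ : List Q → Q → Q) : Prop :=
  ∀ h, ∀ q ∈ G.existential, ∃ x, (q, x, σ h q) ∈ G.δ

/-- The play `π` is compliant with the strategy `σ` of the existential player. -/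
def Compliant (σ : List Q → Q → Q) (π : ℕ → Q × Γ.GraphMonoid) : Prop :=
  ∀ i, (π i).1 ∈ G.existential →
    (π (i + 1)).1 = σ ((List.range i).map fun j => (π j).1) (π i).1

/-- The right-invertibility objective: only right-invertible storage contents are visited. -/
def ViabilityObjective (Γ : ValenceGraph V) (Q : Type*) : Set (ℕ → Q × Γ.GraphMonoid) :=
  {π | ∀ i, (π i).2 ∈ RInv Γ.GraphMonoid}

/-- The existential player wins the viability game from the configuration `c`. -/
def ExistsWins (c : Q × Γ.GraphMonoid) : Prop :=
  ∃ σ : List Q → Q → Q, G.IsStrategy σ ∧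
    ∀ π : ℕ → Q × Γ.GraphMonoid, G.IsPlay π → π 0 = c → G.Compliant σ π → π ∈ ViabilityObjective Γ Q

end GameArena

end Viability

/-!
# Cutting tall group elements out of the stack in viability games

In a graph of `PD(Grp)` the graph monoid acts on stacks in which pushdown letters alternate with
units, by partial maps, and its right-invertible elements are exactly the stack contents, that is,
the elements whose action on the empty stack is defined (`ValenceGraph.Stack.mem_rInv_iff`). Hence
a stack content `z` above a pushdown letter `v` can be treated on its own until a letter pops `v`,
and when this happens, `z` has been reduced to `1`
(`ValenceGraph.push_mul_eq_one_of_not_mem_rInv`). Popping the pushdown letter below a group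
element requires this group element to be trivial
(`ValenceGraph.cls_eq_one_of_mul_pop_mem_rInv`).

From `γ l'` the existential player copies her strategy for `l γ w γ l'` until the upper `γ` is
popped. At this moment her own stack is empty, and she has a winning strategy for the shadow
`l γ w`. It remains to see that, since `w` is taller than the number of states, she then wins from the
empty stack (`GameArena.existsWins_one_of_card_le_wordLength`). Let `B k` be the set of states from which
she wins with some group element of word length at least `k` on top of `l γ`. The sets `B k`
decrease and `B n`, with `n` the number of states, is nonempty, so `B k = B (k + 1)` for some
`k < n`. Whenever her play is at the ground level, in a state of `B k`, she may change the shadow to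
one with a group element of word length at least `k + 1 > 0`: this element is not trivial, so the
strategy for the shadow never pops the `γ` below it, and after one letter over a looped vertex its
word length is still at least `k`. When she is above a pushdown letter pushed on the ground, she
keeps the shadow until this letter is popped; the group element of the shadow is then unchanged.

Strategies are not composed explicitly: the winning region is closed under moves
(`GameArena.ExistsWins.exists_transition`, `GameArena.ExistsWins.forall_transition`), every set
closed in this sense is won (`GameArena.existsWins_of_invariant`), and both arguments above are
instances of the resulting transfer principle `GameArena.existsWins_of_shadow`.
-/

namespace Viability

/-! ### Right-invertible elements -/

namespace RInv

variable {M : Type*} [Monoid M] {x y : M}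

theorem one_mem : (1 : M) ∈ RInv M := ⟨1, one_mul 1⟩

theorem mul_mem (hx : x ∈ RInv M) (hy : y ∈ RInv M) : x * y ∈ RInv M := by
  obtain ⟨x', hx⟩ := hx
  obtain ⟨y', hy⟩ := hy
  refine ⟨y' * x', ?_⟩
  rw [mul_assoc, ← mul_assoc y, hy, one_mul, hx]

theorem of_mul_left (h : x * y ∈ RInv M) : x ∈ RInv M := by
  obtain ⟨z, hz⟩ := h
  exact ⟨y * z, by rw [← mul_assoc, hz]⟩

theorem unit_mem (u : Mˣ) : (u : M) ∈ RInv M := ⟨↑u⁻¹, u.mul_inv⟩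

end RInv

/-! ### Words over the looped vertices -/

/-- The letter with the opposite sign. -/
def Letter.bar {V : Type*} : Letter V → Letter V
  | .pos v => .neg v
  | .neg v => .pos v

@[simp]
theorem Letter.vertex_bar {V : Type*} (x : Letter V) : x.bar.vertex = x.vertex := by
  cases x <;> rfl

@[simp]
theorem Letter.bar_bar {V : Type*} (x : Letter V) : x.bar.bar = x := by
  cases x <;> rfl

namespace ValenceGraph

variable {V : Type*} {Γ : ValenceGraph V}

theorem cls_surjective : Function.Surjective Γ.cls := PresentedMonoid.surjective_mk

theorem cls_push_mul_pop (v : V) : Γ.cls (push v) * Γ.cls (pop v) = 1 := by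
  rw [← map_mul, ← map_one Γ.cls]
  exact PresentedMonoid.mk_eq_mk_of_rel (Rel.cancel v)

theorem cls_push_mem_rInv (v : V) : Γ.cls (push v) ∈ RInv Γ.GraphMonoid :=
  ⟨_, cls_push_mul_pop v⟩

theorem cls_comm {x y : Letter V} (h : Γ.Adj x.vertex y.vertex) :
    Γ.cls (.of x) * Γ.cls (.of y) = Γ.cls (.of y) * Γ.cls (.of x) := by
  rw [← map_mul, ← map_mul]
  exact PresentedMonoid.mk_eq_mk_of_rel (Rel.comm x y h)

theorem cls_mul_cls_bar {x : Letter V} (h : Γ.Looped x.vertex) :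
    Γ.cls (.of x) * Γ.cls (.of x.bar) = 1 := by
  cases x with
  | pos v => exact cls_push_mul_pop v
  | neg v =>
    rw [cls_comm (by exact h)]
    exact cls_push_mul_pop v

/-- A letter over a looped vertex, as a unit of the graph monoid. -/
def loopedUnit (x : Letter V) (h : Γ.Looped x.vertex) : Γ.GraphMonoidˣ where
  val := Γ.cls (.of x)
  inv := Γ.cls (.of x.bar)
  val_inv := cls_mul_cls_bar h
  inv_val := by simpa using cls_mul_cls_bar (x := x.bar) (by simpa using h)

theorem exists_unit_of_isGroupWord {w : Word V} (hw : Γ.IsGroupWord w) :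
    ∃ u : Γ.GraphMonoidˣ, (u : Γ.GraphMonoid) = Γ.cls w := by
  induction w using FreeMonoid.inductionOn' with
  | one => exact ⟨1, by simp⟩
  | of_mul x w ih =>
    obtain ⟨u, hu⟩ := ih fun y hy => hw y (by simp [hy])
    exact ⟨loopedUnit x (hw x (by simp)) * u, by simp [hu, loopedUnit]⟩

theorem isGroupWord_one : Γ.IsGroupWord 1 := by simp [IsGroupWord]

theorem isGroupWord_of {x : Letter V} (h : Γ.Looped x.vertex) : Γ.IsGroupWord (.of x) := by
  simpa [IsGroupWord] using h

theorem IsGroupWord.mul {u w : Word V} (hu : Γ.IsGroupWord u) (hw : Γ.IsGroupWord w) :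
    Γ.IsGroupWord (u * w) := by
  intro x hx
  rw [FreeMonoid.toList_mul, List.mem_append] at hx
  exact hx.elim (hu x) (hw x)

theorem wordLength_cls_le {u : Word V} (hu : Γ.IsGroupWord u) :
    Γ.wordLength (Γ.cls u) ≤ u.length :=
  Nat.sInf_le ⟨u, hu, rfl, rfl⟩

theorem exists_word_length_eq_wordLength {w : Word V} (hw : Γ.IsGroupWord w) :
    ∃ u : Word V, Γ.IsGroupWord u ∧ Γ.cls u = Γ.cls w ∧ u.length = Γ.wordLength (Γ.cls w) :=
  Nat.sInf_mem (s := {k | ∃ u : Word V, Γ.IsGroupWord u ∧ Γ.cls u = Γ.cls w ∧ u.length = k})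
    ⟨_, w, hw, rfl, rfl⟩

theorem wordLength_one : Γ.wordLength 1 = 0 := by
  simpa using wordLength_cls_le (Γ := Γ) isGroupWord_one

theorem wordLength_le_wordLength_mul_of {w : Word V} (hw : Γ.IsGroupWord w) {x : Letter V}
    (hx : Γ.Looped x.vertex) :
    Γ.wordLength (Γ.cls w) ≤ Γ.wordLength (Γ.cls (w * .of x)) + 1 := by
  obtain ⟨u, hu, hcls, hlen⟩ := exists_word_length_eq_wordLength (hw.mul (isGroupWord_of hx))
  have h : Γ.cls (u * .of x.bar) = Γ.cls w := by
    rw [map_mul, hcls, map_mul, mul_assoc, cls_mul_cls_bar hx, mul_one]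
  have hbar : Γ.IsGroupWord (.of x.bar) := isGroupWord_of (by simpa using hx)
  have := wordLength_cls_le (hu.mul hbar)
  rwa [h, FreeMonoid.length_mul, FreeMonoid.length_of, hlen] at this

/-! ### The action of the graph monoid on stacks -/

variable (Γ) in
/-- A stack over `Γ`: the unit on top of the uppermost pushdown letter, and the list, from top to
bottom, of the pushdown letters, each paired with the unit directly below it. The whole unit group
of the graph monoid serves in place of its subgroup generated by the looped vertices. -/
abbrev Stack := Γ.GraphMonoidˣ × List ({v : V // ¬ Γ.Looped v} × Γ.GraphMonoidˣ)

namespace Stack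

/-- The empty stack. -/
def bot : Γ.Stack := (1, [])

/-- The element of the graph monoid represented by the pushdown part of a stack. -/
def evalList : List ({v : V // ¬ Γ.Looped v} × Γ.GraphMonoidˣ) → Γ.GraphMonoid
  | [] => 1
  | (v, g) :: s => evalList s * g * Γ.cls (push v.1)

/-- The element of the graph monoid represented by a stack. -/
def eval (s : Γ.Stack) : Γ.GraphMonoid := evalList s.2 * s.1

theorem eval_mem_rInv (s : Γ.Stack) : s.eval ∈ RInv Γ.GraphMonoid := by
  obtain ⟨g, s⟩ := s
  refine RInv.mul_mem ?_ (RInv.unit_mem g)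
  induction s with
  | nil => exact RInv.one_mem
  | cons a s ih => exact RInv.mul_mem (RInv.mul_mem ih (RInv.unit_mem _)) (cls_push_mem_rInv _)

open Classical in
/-- The effect of a letter on a stack. A letter over a looped vertex multiplies the topmost unit,
and a pushdown letter is pushed or popped; popping fails (with value `none`) unless the topmost
unit is trivial and lies on that letter. -/
noncomputable def step (s : Γ.Stack) (x : Letter V) : Option Γ.Stack :=
  if h : Γ.Looped x.vertex then some (s.1 * loopedUnit x h, s.2)
  else match x, s with
    | .pos v, (g, s) => some (1, (⟨v, h⟩, g) :: s)
    | .neg _, (_, []) => none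
    | .neg v, (g, (u, g') :: s) => if g = 1 ∧ u.1 = v then some (g', s) else none

theorem step_looped (s : Γ.Stack) {x : Letter V} (h : Γ.Looped x.vertex) :
    s.step x = some (s.1 * loopedUnit x h, s.2) := by
  rw [step, dif_pos h]

theorem step_pos (g : Γ.GraphMonoidˣ) (s) {v : V} (h : ¬ Γ.Looped v) :
    step (g, s) (.pos v) = some (1, (⟨v, h⟩, g) :: s) := by
  rw [step, dif_neg (by exact h)]

theorem step_neg_nil (g : Γ.GraphMonoidˣ) {v : V} (h : ¬ Γ.Looped v) :
    step (g, []) (.neg v) = none := by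
  rw [step, dif_neg (by exact h)]

open Classical in
theorem step_neg_cons (g : Γ.GraphMonoidˣ) (u g' s) {v : V} (h : ¬ Γ.Looped v) :
    step (g, (u, g') :: s) (.neg v) = if g = 1 ∧ u.1 = v then some (g', s) else none := by
  rw [step, dif_neg (by exact h)]

theorem eval_step {s t : Γ.Stack} {x : Letter V} (h : s.step x = some t) :
    t.eval = s.eval * Γ.cls (.of x) := by
  obtain ⟨g, s⟩ := s
  by_cases hx : Γ.Looped x.vertex
  · rw [step_looped _ hx, Option.some_inj] at h
    subst h
    simp [eval, loopedUnit, mul_assoc]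
  · rcases x with v | v
    all_goals change ¬ Γ.Looped v at hx
    · rw [step_pos _ _ hx, Option.some_inj] at h
      subst h
      simp [eval, evalList, push]
    · rcases s with _ | ⟨⟨u, g'⟩, s⟩
      · simp [step_neg_nil _ hx] at h
      · rw [step_neg_cons _ _ _ _ hx] at h
        split_ifs at h with hc
        obtain ⟨rfl, rfl⟩ := hc
        rw [Option.some_inj] at h
        subst h
        have := cls_push_mul_pop (Γ := Γ) u.1
        rw [pop] at this
        simp [eval, evalList, mul_assoc, this]

/-- The letters act on stacks compatibly with the relations of the graph monoid. -/
theorem lift_step_eq_of_rel (hΓ : Γ.IsPDGrp) (a b : Word V) (h : Γ.Rel a b) :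
    FreeMonoid.lift (M := (Function.End (Option Γ.Stack))ᵐᵒᵖ)
        (fun x => .op fun o => o.bind fun s => s.step x) a =
      FreeMonoid.lift (fun x => .op fun o => o.bind fun s => s.step x) b := by
  apply MulOpposite.unop_injective
  funext o
  cases h with
  | cancel v =>
    rcases o with _ | ⟨g, s⟩
    · rfl
    · change ((step (g, s) (.pos v)).bind fun s => s.step (.neg v)) = some (g, s)
      by_cases hv : Γ.Looped v
      · rw [step_looped _ (by exact hv), Option.bind_some, step_looped _ (by exact hv)]
        have : loopedUnit (.pos v) hv * loopedUnit (.neg v) hv = 1 :=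
          Units.ext (cls_push_mul_pop v)
        simp [mul_assoc, this]
      · rw [step_pos _ _ hv, Option.bind_some, step_neg_cons _ _ _ _ hv]
        simp
  | comm x y h =>
    have hx : Γ.Looped x.vertex := by
      by_contra hx
      exact hΓ _ _ hx h
    have hy : Γ.Looped y.vertex := by
      by_contra hy
      exact hΓ _ _ hy (Γ.symm _ _ h)
    rcases o with _ | s
    · rfl
    · change ((s.step x).bind fun s => s.step y) = (s.step y).bind fun s => s.step x
      rw [step_looped _ hx, step_looped _ hy, Option.bind_some, Option.bind_some,
        step_looped _ hx, step_looped _ hy]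
      have : loopedUnit x hx * loopedUnit y hy = loopedUnit y hy * loopedUnit x hx :=
        Units.ext (cls_comm h)
      simp [mul_assoc, this]

/-- The right action of the graph monoid on stacks by partial maps; the absorbing value `none`
stands for failure. -/
noncomputable def run (hΓ : Γ.IsPDGrp) (o : Option Γ.Stack) (g : Γ.GraphMonoid) :
    Option Γ.Stack :=
  (PresentedMonoid.lift (M := (Function.End (Option Γ.Stack))ᵐᵒᵖ) _
    (lift_step_eq_of_rel hΓ) g).unop o

variable (hΓ : Γ.IsPDGrp)

theorem run_one (o : Option Γ.Stack) : run hΓ o 1 = o := by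
  simp only [run, map_one]
  rfl

theorem run_mul (o : Option Γ.Stack) (g h : Γ.GraphMonoid) :
    run hΓ o (g * h) = run hΓ (run hΓ o g) h := by
  simp only [run, map_mul]
  rfl

theorem run_of (s : Γ.Stack) (x : Letter V) : run hΓ (some s) (Γ.cls (.of x)) = s.step x :=
  rfl

theorem run_none (g : Γ.GraphMonoid) : run hΓ none g = none := by
  obtain ⟨w, rfl⟩ := cls_surjective g
  induction w using FreeMonoid.inductionOn' with
  | one => exact run_one hΓ _
  | of_mul x w ih =>
    rw [map_mul, run_mul]
    exact ih

theorem eval_run {s t : Γ.Stack} {g : Γ.GraphMonoid} (h : run hΓ (some s) g = some t) :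
    t.eval = s.eval * g := by
  obtain ⟨w, rfl⟩ := cls_surjective g
  induction w using FreeMonoid.inductionOn' generalizing s with
  | one =>
    rw [map_one, run_one, Option.some_inj] at h
    rw [map_one, mul_one, h]
  | of_mul x w ih =>
    rw [map_mul, run_mul] at h
    change run hΓ (s.step x) _ = _ at h
    rcases hs : s.step x with _ | s'
    · rw [hs, run_none] at h
      cases h
    · rw [hs] at h
      rw [ih h, eval_step hs, map_mul, mul_assoc]

/-- A valid step on a stack is not affected by what lies below it. -/
theorem step_append {g g' : Γ.GraphMonoidˣ} {s s'} {x : Letter V}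
    (h : step (g, s) x = some (g', s')) (t) : step (g, s ++ t) x = some (g', s' ++ t) := by
  by_cases hx : Γ.Looped x.vertex
  · rw [step_looped _ hx] at h ⊢
    simp_all
  · rcases x with v | v
    all_goals change ¬ Γ.Looped v at hx
    · rw [step_pos _ _ hx] at h ⊢
      simp at h
      simp [← h.1, ← h.2]
    · rcases s with _ | ⟨⟨u, g''⟩, s⟩
      · simp [step_neg_nil _ hx] at h
      · rw [List.cons_append, step_neg_cons _ _ _ _ hx] at *
        split_ifs at h ⊢ with hc
        simp_all

theorem run_append {g g' : Γ.GraphMonoidˣ} {s s'} {z : Γ.GraphMonoid}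
    (h : run hΓ (some (g, s)) z = some (g', s')) (t) :
    run hΓ (some (g, s ++ t)) z = some (g', s' ++ t) := by
  obtain ⟨w, rfl⟩ := cls_surjective z
  induction w using FreeMonoid.inductionOn' generalizing g s with
  | one =>
    rw [map_one, run_one, Option.some_inj, Prod.mk.injEq] at h
    rw [map_one, run_one, h.1, h.2]
  | of_mul x w ih =>
    rw [map_mul, run_mul] at h ⊢
    change run hΓ (step (g, s) x) _ = _ at h
    change run hΓ (step (g, s ++ t) x) _ = _
    rcases hs : step (g, s) x with _ | ⟨g₁, s₁⟩
    · rw [hs, run_none] at h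
      cases h
    · rw [step_append hs]
      rw [hs] at h
      exact ih h

/-- The right-invertible elements are exactly the valid stack contents. -/
theorem mem_rInv_iff {x : Γ.GraphMonoid} :
    x ∈ RInv Γ.GraphMonoid ↔ ∃ s, run hΓ (some bot) x = some s := by
  constructor
  · rintro ⟨y, hxy⟩
    have h := run_mul hΓ (some bot) x y
    rw [hxy, run_one] at h
    rcases hs : run hΓ (some bot) x with _ | s
    · rw [hs, run_none] at h
      cases h
    · exact ⟨s, rfl⟩
  · rintro ⟨s, hs⟩
    have h := eval_run hΓ hs
    simp only [bot, eval, evalList, Units.val_one, mul_one, one_mul] at h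
    rw [← h]
    exact eval_mem_rInv s

theorem run_isGroupWord {w : Word V} (hw : Γ.IsGroupWord w) (g : Γ.GraphMonoidˣ) (s) :
    ∃ u : Γ.GraphMonoidˣ, (u : Γ.GraphMonoid) = Γ.cls w ∧
      run hΓ (some (g, s)) (Γ.cls w) = some (g * u, s) := by
  induction w using FreeMonoid.inductionOn' generalizing g with
  | one => exact ⟨1, by simp, by simp [run_one]⟩
  | of_mul x w ih =>
    have hx : Γ.Looped x.vertex := hw x (by simp)
    obtain ⟨u, hu, hrun⟩ := ih (fun y hy => hw y (by simp [hy])) (g * loopedUnit x hx)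
    refine ⟨loopedUnit x hx * u, by simp [hu, loopedUnit], ?_⟩
    rw [map_mul, run_mul, run_of, step_looped _ hx, hrun, mul_assoc]

/-- If a step is invalid on a stack but becomes valid once more letters are put below it, then it
pops the first of these letters through the empty stack. -/
theorem step_append_of_step_eq_none {g : Γ.GraphMonoidˣ} {s t} {x : Letter V}
    (h : step (g, s) x = none) (h' : step (g, s ++ t) x ≠ none) :
    g = 1 ∧ s = [] ∧ ∃ u t', x = .neg u.1.1 ∧ t = u :: t' := by
  by_cases hx : Γ.Looped x.vertex
  · simp [step_looped _ hx] at h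
  · rcases x with v | v
    all_goals change ¬ Γ.Looped v at hx
    · simp [step_pos _ _ hx] at h
    · rcases s with _ | ⟨⟨u, g'⟩, s⟩
      · rcases t with _ | ⟨⟨u, g'⟩, t⟩
        · simp [step_neg_nil _ hx] at h'
        · rw [List.nil_append, step_neg_cons _ _ _ _ hx] at h'
          split_ifs at h' with hc
          · exact ⟨hc.1, rfl, (u, g'), t, by rw [hc.2], rfl⟩
          · exact absurd rfl h'
      · rw [List.cons_append, step_neg_cons _ _ _ _ hx] at h'
        rw [step_neg_cons _ _ _ _ hx] at h
        split_ifs at h h' with hc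
        exact absurd rfl h'

/-- A pushdown letter is never cancelled against what lies below it when it is pushed. -/
theorem run_mul_push {h : Γ.GraphMonoid} {v : V} (hv : ¬ Γ.Looped v)
    (hh : h * Γ.cls (push v) ∈ RInv Γ.GraphMonoid) :
    ∃ g s, run hΓ (some bot) (h * Γ.cls (push v)) = some (1, (⟨v, hv⟩, g) :: s) := by
  obtain ⟨⟨g, s⟩, hs⟩ := (mem_rInv_iff hΓ).1 (RInv.of_mul_left hh)
  exact ⟨g, s, by rw [run_mul, hs]; exact step_pos _ _ hv⟩

end Stack

/-! ### Popping a pushdown letter -/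

/-- If multiplication by a letter leads from a valid stack content `z` out of the valid ones, but
not so above a pushdown letter `v`, then it removes `v`, and `z` is trivial. -/
theorem push_mul_eq_one_of_not_mem_rInv (hΓ : Γ.IsPDGrp) {v : V} (hv : ¬ Γ.Looped v)
    {h z : Γ.GraphMonoid} {x : Word V} (hx : x.length ≤ 1) (hz : z ∈ RInv Γ.GraphMonoid)
    (hzx : z * Γ.cls x ∉ RInv Γ.GraphMonoid)
    (hh : h * Γ.cls (push v) * (z * Γ.cls x) ∈ RInv Γ.GraphMonoid) :
    Γ.cls (push v) * (z * Γ.cls x) = 1 := by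
  obtain ⟨g₀, s₀, hrun⟩ := Stack.run_mul_push hΓ hv (RInv.of_mul_left hh)
  obtain hx | hx := Nat.le_one_iff_eq_zero_or_eq_one.1 hx
  · rw [FreeMonoid.length_eq_zero] at hx
    simp [hx, hz] at hzx
  · obtain ⟨a, rfl⟩ := FreeMonoid.length_eq_one.1 hx
    obtain ⟨⟨g, s⟩, hs⟩ := (Stack.mem_rInv_iff hΓ).1 hz
    obtain ⟨t, ht⟩ := (Stack.mem_rInv_iff hΓ).1 hh
    rw [Stack.run_mul, hrun, Stack.run_mul, ← List.nil_append (_ :: _),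
      Stack.run_append hΓ hs, Stack.run_of] at ht
    have hnone : Stack.step (g, s) a = none := by
      rw [← Stack.run_of hΓ, ← hs, ← Stack.run_mul]
      by_contra hne
      exact hzx ((Stack.mem_rInv_iff hΓ).2 (Option.ne_none_iff_exists'.1 hne))
    obtain ⟨rfl, rfl, u, t', rfl, ht'⟩ :=
      Stack.step_append_of_step_eq_none hnone (Option.ne_none_iff_exists'.2 ⟨t, ht⟩)
    rw [List.cons.injEq] at ht'
    obtain ⟨rfl, -⟩ := ht'
    have hz1 : z = 1 := by
      simpa [Stack.bot, Stack.eval, Stack.evalList] using (Stack.eval_run hΓ hs).symm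
    rw [hz1, one_mul]
    exact cls_push_mul_pop v

/-- A pushdown letter can be popped above a group element that lies on another pushdown letter
only if this group element is trivial. -/
theorem cls_eq_one_of_mul_pop_mem_rInv (hΓ : Γ.IsPDGrp) {u v : V} (hu : ¬ Γ.Looped u)
    (hv : ¬ Γ.Looped v)
    {h : Γ.GraphMonoid} {w : Word V} (hw : Γ.IsGroupWord w)
    (hh : h * Γ.cls (push v) * Γ.cls w * Γ.cls (pop u) ∈ RInv Γ.GraphMonoid) :
    Γ.cls w = 1 := by
  obtain ⟨g₀, s₀, hrun⟩ := Stack.run_mul_push hΓ hv (RInv.of_mul_left (RInv.of_mul_left hh))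
  obtain ⟨t, ht⟩ := (Stack.mem_rInv_iff hΓ).1 hh
  obtain ⟨g, hg, hw'⟩ := Stack.run_isGroupWord hΓ hw 1 ((⟨v, hv⟩, g₀) :: s₀)
  rw [Stack.run_mul, Stack.run_mul, hrun, hw', pop, Stack.run_of, Stack.step_neg_cons _ _ _ _ hu,
    one_mul] at ht
  split_ifs at ht with hc
  rw [← hg, hc.1, Units.val_one]

end ValenceGraph

/-! ### Winning regions of viability games -/

namespace GameArena

variable {V Q : Type*} {Γ : ValenceGraph V} {G : GameArena Γ Q}

/-- Every strategy admits a compliant play from every configuration, so winning is never vacuous. -/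
theorem Compliant.exists_of_isStrategy {σ : List Q → Q → Q} (hσ : G.IsStrategy σ)
    (c : Q × Γ.GraphMonoid) : ∃ π, G.IsPlay π ∧ π 0 = c ∧ G.Compliant σ π := by
  have hnext : ∀ h q, ∃ x q', (q, x, q') ∈ G.δ ∧ (q ∈ G.existential → q' = σ h q) := by
    intro h q
    by_cases hq : q ∈ G.existential
    · obtain ⟨x, hx⟩ := hσ h q hq
      exact ⟨x, _, hx, fun _ => rfl⟩
    · obtain ⟨x, q', hx⟩ := G.exists_transition q
      exact ⟨x, q', hx, fun hq' => absurd hq' hq⟩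
  choose x q' hδ hq' using hnext
  -- The play is built together with the list of the states visited before.
  let s : ℕ → List Q × Q × Γ.GraphMonoid := fun i =>
    Nat.rec ([], c) (fun _ t =>
      (t.1 ++ [t.2.1], q' t.1 t.2.1, t.2.2 * Γ.cls (x t.1 t.2.1))) i
  have hs : ∀ i, (s i).1 = (List.range i).map fun j => (s j).2.1 := by
    intro i
    induction i with
    | zero => rfl
    | succ i ih => rw [List.range_succ, List.map_append, ← ih]; rfl
  refine ⟨fun i => (s i).2, fun i => ⟨_, hδ (s i).1 (s i).2.1, rfl⟩, rfl, fun i hi => ?_⟩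
  rw [← hs]
  exact hq' _ _ hi

namespace ExistsWins

theorem mem_rInv {p : Q} {g : Γ.GraphMonoid} (h : G.ExistsWins (p, g)) :
    g ∈ RInv Γ.GraphMonoid := by
  obtain ⟨σ, hσ, hwin⟩ := h
  obtain ⟨π, hπ, h0, hc⟩ := Compliant.exists_of_isStrategy hσ (p, g)
  simpa [h0] using hwin π hπ h0 hc 0

/-- After a transition that complies with a winning strategy, the rest of this strategy wins. -/
theorem of_transition {σ : List Q → Q → Q} (hσ : G.IsStrategy σ) {p q : Q} {g : Γ.GraphMonoid}
    {x : Word V} (hx : (p, x, q) ∈ G.δ) (hq : p ∈ G.existential → q = σ [] p)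
    (hwin : ∀ π, G.IsPlay π → π 0 = (p, g) → G.Compliant σ π → π ∈ ViabilityObjective Γ Q) :
    G.ExistsWins (q, g * Γ.cls x) := by
  refine ⟨fun h => σ (p :: h), fun h => hσ (p :: h), fun π hπ h0 hc i => ?_⟩
  refine hwin (fun i => Nat.casesOn i (p, g) π) ?_ rfl ?_ (i + 1)
  · rintro (_ | i)
    · exact ⟨x, by simpa [h0] using hx, by simp [h0]⟩
    · exact hπ i
  · rintro (_ | i) hi
    · simpa [h0] using hq hi
    · simpa [List.range_succ_eq_map, Function.comp_def] using hc i hi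

theorem exists_transition {p : Q} {g : Γ.GraphMonoid} (h : G.ExistsWins (p, g))
    (hp : p ∈ G.existential) : ∃ x q, (p, x, q) ∈ G.δ ∧ G.ExistsWins (q, g * Γ.cls x) := by
  obtain ⟨σ, hσ, hwin⟩ := h
  obtain ⟨x, hx⟩ := hσ [] p hp
  exact ⟨x, _, hx, of_transition hσ hx (fun _ => rfl) hwin⟩

theorem forall_transition {p : Q} {g : Γ.GraphMonoid} (h : G.ExistsWins (p, g))
    (hp : p ∉ G.existential) {x : Word V} {q : Q} (hx : (p, x, q) ∈ G.δ) :
    G.ExistsWins (q, g * Γ.cls x) := by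
  obtain ⟨σ, hσ, hwin⟩ := h
  exact of_transition hσ hx (fun hp' => absurd hp' hp) hwin

end ExistsWins

open Classical in
/-- The label of the transition from `p` to `q`, or the empty word if there is none. -/
noncomputable def label (G : GameArena Γ Q) (p q : Q) : Word V :=
  if h : ∃ x, (p, x, q) ∈ G.δ then h.choose else 1

theorem label_eq {p q : Q} {x : Word V} (hx : (p, x, q) ∈ G.δ) : G.label p q = x := by
  have h : ∃ x, (p, x, q) ∈ G.δ := ⟨x, hx⟩
  rw [label, dif_pos h]
  exact G.transition_unique _ _ _ _ h.choose_spec hx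

/-- The word read along a sequence of states. -/
noncomputable def pathWord (G : GameArena Γ Q) : List Q → Word V
  | [] => 1
  | [_] => 1
  | p :: q :: h => G.label p q * pathWord G (q :: h)

theorem pathWord_append (h : List Q) (p q : Q) :
    G.pathWord (h ++ [p, q]) = G.pathWord (h ++ [p]) * G.label p q := by
  induction h with
  | nil => simp [pathWord]
  | cons a h ih =>
    cases h with
    | nil => simp [pathWord]
    | cons b h =>
      simp only [List.cons_append, pathWord] at ih ⊢
      rw [ih, mul_assoc]

theorem IsPlay.snd_eq {π : ℕ → Q × Γ.GraphMonoid} (hπ : G.IsPlay π) (i : ℕ) :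
    (π i).2 = (π 0).2 *
      Γ.cls (G.pathWord (((List.range i).map fun j => (π j).1) ++ [(π i).1])) := by
  induction i with
  | zero => simp [pathWord]
  | succ i ih =>
    obtain ⟨x, hx, hmul⟩ := hπ i
    rw [List.range_succ, List.map_append, List.append_assoc, hmul, ih, mul_assoc]
    simp only [List.map_cons, List.map_nil, List.cons_append, List.nil_append]
    rw [pathWord_append, map_mul, label_eq hx]

/-- Since a transition is determined by its end points, the visited states determine the storage
content. The existential player therefore wins from every set of configurations with
right-invertible contents which she can keep from being left. -/
theorem existsWins_of_invariant (C : Set (Q × Γ.GraphMonoid))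
    (hC : ∀ p g, (p, g) ∈ C → g ∈ RInv Γ.GraphMonoid)
    (hex : ∀ p g, (p, g) ∈ C → p ∈ G.existential →
      ∃ x q, (p, x, q) ∈ G.δ ∧ (q, g * Γ.cls x) ∈ C)
    (hall : ∀ p g, (p, g) ∈ C → p ∉ G.existential →
      ∀ x q, (p, x, q) ∈ G.δ → (q, g * Γ.cls x) ∈ C)
    {c : Q × Γ.GraphMonoid} (hc : c ∈ C) : G.ExistsWins c := by
  have hchoice : ∀ p g, ∃ q, (∃ x, (p, x, q) ∈ G.δ) ∧
      ((p, g) ∈ C → p ∈ G.existential → (q, g * Γ.cls (G.label p q)) ∈ C) := by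
    intro p g
    by_cases h : (p, g) ∈ C ∧ p ∈ G.existential
    · obtain ⟨x, q, hx, hq⟩ := hex p g h.1 h.2
      exact ⟨q, ⟨x, hx⟩, fun _ _ => by rwa [label_eq hx]⟩
    · obtain ⟨x, q, hx⟩ := G.exists_transition p
      exact ⟨q, ⟨x, hx⟩, fun h₁ h₂ => absurd ⟨h₁, h₂⟩ h⟩
  choose next hδ hnext using hchoice
  refine ⟨fun h q => next q (c.2 * Γ.cls (G.pathWord (h ++ [q]))),
    fun h q _ => hδ _ _, fun π hπ h0 hcomp => ?_⟩
  suffices h : ∀ i, π i ∈ C from fun i => hC _ _ (h i)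
  intro i
  induction i with
  | zero => rwa [h0]
  | succ i ih =>
    obtain ⟨x, hx, hmul⟩ := hπ i
    suffices h : ((π (i + 1)).1, (π i).2 * Γ.cls x) ∈ C by rwa [← hmul] at h
    by_cases hi : (π i).1 ∈ G.existential
    · have hstate := hcomp i hi
      dsimp only at hstate
      rw [← h0, ← hπ.snd_eq i] at hstate
      have := hnext _ _ ih hi
      rwa [← hstate, label_eq hx] at this
    · exact hall _ _ ih hi _ _ hx

/-- Strategy transfer: the existential player wins from a set `C` of configurations with
right-invertible contents if each of them is shadowed by a configuration with the same state that
she wins, such that a step stays in `C` whenever its shadow stays won. -/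
theorem existsWins_of_shadow (C : Set (Q × Γ.GraphMonoid))
    (hC : ∀ p g, (p, g) ∈ C → g ∈ RInv Γ.GraphMonoid ∧ ∃ h, G.ExistsWins (p, h) ∧
      ∀ x q, (p, x, q) ∈ G.δ → G.ExistsWins (q, h * Γ.cls x) → (q, g * Γ.cls x) ∈ C)
    {c : Q × Γ.GraphMonoid} (hc : c ∈ C) : G.ExistsWins c := by
  refine existsWins_of_invariant C (fun p g hg => (hC p g hg).1) ?_ ?_ hc
  · intro p g hg hp
    obtain ⟨-, h, hwin, hstep⟩ := hC p g hg
    obtain ⟨x, q, hx, hq⟩ := hwin.exists_transition hp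
    exact ⟨x, q, hx, hstep x q hx hq⟩
  · intro p g hg hp x q hx
    obtain ⟨-, h, hwin, hstep⟩ := hC p g hg
    exact hstep x q hx (hwin.forall_transition hp hx)

/-! ### Group elements that are too tall to be cancelled -/

/-- The states from which the existential player wins with some group element of word length at
least `k` on top of the stack content `b`. -/
def winningAbove (G : GameArena Γ Q) (b : Γ.GraphMonoid) (k : ℕ) : Set Q :=
  {p | ∃ w, Γ.IsGroupWord w ∧ k ≤ Γ.wordLength (Γ.cls w) ∧ G.ExistsWins (p, b * Γ.cls w)}

theorem winningAbove_antitone (b : Γ.GraphMonoid) : Antitone (G.winningAbove b) :=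
  fun _ _ hkm _ ⟨w, hw, hm, hwin⟩ => ⟨w, hw, hkm.trans hm, hwin⟩

/-- A decreasing chain of sets that is still nonempty after as many steps as there are elements is
stationary at some step before. -/
theorem _root_.Set.exists_subset_succ_of_antitone {α : Type*} [Fintype α] {B : ℕ → Set α}
    (hB : Antitone B) (hne : (B (Fintype.card α)).Nonempty) :
    ∃ k < Fintype.card α, B k ⊆ B (k + 1) := by
  by_contra! h
  have hcard : ∀ k ≤ Fintype.card α, (B k).ncard + k ≤ Fintype.card α := by
    intro k
    induction k with
    | zero => simpa using Set.ncard_le_card (B 0)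
    | succ k ih =>
      intro hk
      have : (B (k + 1)).ncard < (B k).ncard :=
        Set.ncard_lt_ncard (ssubset_of_subset_not_subset (hB k.le_succ) (h k hk))
      have := ih (by omega)
      lia
  have := hcard _ le_rfl
  have := hne.ncard_pos
  omega

/-- A tall group element on a pushdown letter `v` protects this letter: if the existential player
wins with it, then she also wins from the empty stack. -/
theorem existsWins_one_of_card_le_wordLength [Fintype Q] (hΓ : Γ.IsPDGrp) (hG : G.SingleLetter)
    {v : V} (hv : ¬ Γ.Looped v) {b : Γ.GraphMonoid} {w : Word V} (hw : Γ.IsGroupWord w)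
    (hcard : Fintype.card Q ≤ Γ.wordLength (Γ.cls w)) {p : Q}
    (hwin : G.ExistsWins (p, b * Γ.cls (push v) * Γ.cls w)) : G.ExistsWins (p, 1) := by
  set B := G.winningAbove (b * Γ.cls (push v))
  have hp : p ∈ B (Fintype.card Q) := ⟨w, hw, hcard, hwin⟩
  obtain ⟨k, hk, hsub⟩ := Set.exists_subset_succ_of_antitone (winningAbove_antitone _) ⟨p, hp⟩
  -- On the ground, only the state matters; above a pushdown letter `u` that was pushed on the
  -- ground, the part of the stack from `u` on is shared with the shadow.
  refine existsWins_of_shadow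
    ({c | c.1 ∈ B k ∧ ∃ g, Γ.IsGroupWord g ∧ Γ.cls g = c.2} ∪
      {c | ∃ g w u z, Γ.IsGroupWord g ∧ Γ.IsGroupWord w ∧ k ≤ Γ.wordLength (Γ.cls w) ∧
        ¬ Γ.Looped u ∧ z ∈ RInv Γ.GraphMonoid ∧ c.2 = Γ.cls g * (Γ.cls (push u) * z) ∧
        G.ExistsWins (c.1, b * Γ.cls (push v) * Γ.cls w * Γ.cls (push u) * z)}) ?_
    (.inl ⟨winningAbove_antitone _ hk.le hp, 1, ValenceGraph.isGroupWord_one, map_one _⟩)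
  rintro q _ (⟨hq, g, hg, rfl⟩ | ⟨g, w', u, z, hg, hw', hlen, hu, hz, heq, hwin'⟩)
  · obtain ⟨g', hg'⟩ := ValenceGraph.exists_unit_of_isGroupWord hg
    obtain ⟨w', hw', hlen, hwin'⟩ := hsub hq
    refine ⟨hg' ▸ RInv.unit_mem g', _, hwin', fun x r hx hr => ?_⟩
    obtain hx1 | hx1 := Nat.le_one_iff_eq_zero_or_eq_one.1 (hG _ _ _ hx)
    · rw [FreeMonoid.length_eq_zero] at hx1
      subst hx1
      rw [map_one, mul_one] at hr ⊢
      exact .inl ⟨⟨w', hw', by omega, hr⟩, g, hg, rfl⟩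
    · obtain ⟨a, rfl⟩ := FreeMonoid.length_eq_one.1 hx1
      by_cases ha : Γ.Looped a.vertex
      · have := ValenceGraph.wordLength_le_wordLength_mul_of hw' ha
        have ha' := ValenceGraph.isGroupWord_of ha
        refine .inl ⟨⟨w' * .of a, hw'.mul ha', by omega, ?_⟩, g * .of a, hg.mul ha', map_mul _ _ _⟩
        rwa [map_mul, ← mul_assoc]
      · rcases a with u | u
        · refine .inr ⟨g, w', u, 1, hg, hw', by omega, ha, RInv.one_mem, ?_, ?_⟩
          · rw [mul_one, push]
          · rwa [mul_one]
        · have := ValenceGraph.cls_eq_one_of_mul_pop_mem_rInv hΓ ha hv hw' hr.mem_rInv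
          rw [this, ValenceGraph.wordLength_one] at hlen
          omega
  · obtain ⟨g', hg'⟩ := ValenceGraph.exists_unit_of_isGroupWord hg
    dsimp only at heq hwin'
    subst heq
    refine ⟨RInv.mul_mem (hg' ▸ RInv.unit_mem g')
      (RInv.mul_mem (ValenceGraph.cls_push_mem_rInv u) hz), _, hwin', fun x r hx hr => ?_⟩
    rw [mul_assoc _ z] at hr
    by_cases hzx : z * Γ.cls x ∈ RInv Γ.GraphMonoid
    · exact .inr ⟨g, w', u, _, hg, hw', hlen, hu, hzx, by simp only [mul_assoc], hr⟩
    · have h1 := ValenceGraph.push_mul_eq_one_of_not_mem_rInv hΓ hu (hG _ _ _ hx) hz hzx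
        hr.mem_rInv
      rw [mul_assoc _ (Γ.cls (push u)), h1, mul_one] at hr
      exact .inl ⟨⟨w', hw', hlen, hr⟩, g, hg, by simp only [mul_assoc, h1, mul_one]⟩

end GameArena

end Viability

open Viability in
theorem mainTheorem7 {V Q : Type*} [Finite V] [Fintype Q]
    (Γ : Viability.ValenceGraph V) (hΓ : Γ.IsPDGrp)
    (G : Viability.GameArena Γ Q) (hG : G.SingleLetter)
    (γ : V) (hγ : ¬ Γ.Looped γ)
    (l w l' : Viability.Word V)
    (hw : Γ.IsGroupWord w) (hwn : Fintype.card Q < Γ.wordLength (Γ.cls w))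
    (hl' : Γ.cls l' ∈ Viability.RInv Γ.GraphMonoid)
    (hwin : G.ExistsWins
      (G.init, Γ.cls (l * Viability.push γ * w * Viability.push γ * l'))) :
    G.ExistsWins (G.init, Γ.cls (Viability.push γ * l')) := by
  -- The strategy is copied while the play stays above the upper `γ`; when this letter is popped,
  -- the shadow has content `l γ w`, and play continues with a winning strategy
  -- from the empty stack.
  refine GameArena.existsWins_of_shadow
    ({c | ∃ z ∈ RInv Γ.GraphMonoid, c.2 = Γ.cls (push γ) * z ∧
      G.ExistsWins (c.1, Γ.cls (l * push γ * w) * Γ.cls (push γ) * z)} ∪ {c | G.ExistsWins c}) ?_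
    (.inl ⟨Γ.cls l', hl', map_mul _ _ _, by rwa [← map_mul, ← map_mul]⟩)
  rintro p g (⟨z, hz, heq, hwin'⟩ | hwin')
  · dsimp only at heq hwin'
    subst heq
    refine ⟨RInv.mul_mem (ValenceGraph.cls_push_mem_rInv γ) hz, _, hwin', fun x q hx hq => ?_⟩
    rw [mul_assoc _ z] at hq
    by_cases hzx : z * Γ.cls x ∈ RInv Γ.GraphMonoid
    · exact .inl ⟨_, hzx, mul_assoc _ _ _, hq⟩
    · have h1 := ValenceGraph.push_mul_eq_one_of_not_mem_rInv hΓ hγ (hG _ _ _ hx) hz hzx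
        hq.mem_rInv
      rw [mul_assoc _ (Γ.cls (push γ)), h1, mul_one, map_mul, map_mul] at hq
      refine .inr ?_
      rw [mul_assoc, h1]
      exact GameArena.existsWins_one_of_card_le_wordLength hΓ hG hγ hw hwn.le hq
  · exact ⟨hwin'.mem_rInv, g, hwin', fun x q _ hq => .inr hq⟩
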